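/- For $n \ge 0$ let $A_3(n)$ denote the number of ordered pairs $(\lambda_1,\lambda_2)$ of partitions (either may be empty) with $|\lambda_1|+|\lambda_2| = n$ such that $\lambda_1$ and $\lambda_2$ are both $3$-cores, that is, none of their hook numbers is a multiple of $3$. Let $p$ be an odd prime and let $j \ge 1$ be an integer. Then there is a positive integer $k_0$, namely $k_0 = p^j(p-1)/2$, such that for all integers $n, \alpha \ge 0$ the number $\bigl(2^{2k_0(\alpha+1)-1}-2\bigr)/3$ is an integer and $$A_3\Bigl(4^{k_0(\alpha+1)}\, n + \frac{2^{2k_0(\alpha+1)-1}-2}{3}\Bigr) \equiv 0 \pmod{p^j}.$$ -/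

import Mathlib

/-- The hook number of the cell `(i, j)` of a Young diagram: the cells strictly to its right in
row `i`, the cells strictly below it in column `j`, and the cell itself. It is meant for cells of
the diagram, where no subtraction truncates. -/
def YoungDiagram.hookNumber (μ : YoungDiagram) (i j : ℕ) : ℕ :=
  (μ.rowLen i - (j + 1)) + (μ.colLen j - (i + 1)) + 1

/-- The Young diagram of a partition: its rows are the parts in nonincreasing order. -/
def Nat.Partition.youngDiagram {n : ℕ} (l : n.Partition) : YoungDiagram :=
  YoungDiagram.ofRowLens (l.parts.sort (· ≥ ·)) (l.parts.pairwise_sort (· ≥ ·)).sortedGE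

/-- A partition is a `t`-core if none of its hook numbers is a multiple of `t`. -/
def Nat.Partition.IsCore {n : ℕ} (t : ℕ) (l : n.Partition) : Prop :=
  ∀ c ∈ l.youngDiagram.cells, ¬ t ∣ l.youngDiagram.hookNumber c.1 c.2

instance Nat.Partition.decidableIsCore {n : ℕ} (t : ℕ) (l : n.Partition) :
    Decidable (l.IsCore t) :=
  inferInstanceAs (Decidable (∀ c ∈ l.youngDiagram.cells,
    ¬ t ∣ l.youngDiagram.hookNumber c.1 c.2))

/-- The `t`-core partitions of `n`. -/
def corePartitions (t n : ℕ) : Finset n.Partition :=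
  Finset.univ.filter fun l => l.IsCore t

/-- The partition pairs of `n` with `t`-cores: ordered pairs of `t`-core partitions, of `k` and of
`m`, where `k + m = n`. -/
def corePartitionPairs (t n : ℕ) : Finset (Σ s : ℕ × ℕ, s.1.Partition × s.2.Partition) :=
  (Finset.HasAntidiagonal.antidiagonal n).sigma fun s => corePartitions t s.1 ×ˢ corePartitions t s.2

/-- The number of partition pairs of `n` with 3-cores. -/
def A₃ (n : ℕ) : ℕ := (corePartitionPairs 3 n).card

/-!
The bead set of a 3-core fills initial segments, of lengths `a` and `b`, of the runners 1 and 2 of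
the 3-abacus, and the core has size `n = a² - ab + b² + b`. Then `3n + 1` is the norm of the
Eisenstein integer `1 - (1 + 2ω)(a + bω)`, and every Eisenstein integer of norm `3n + 1` is a unit
times exactly one such element. Since norms are never 2 modulo 3, `36 A₃(n) = R(3n + 2)`, where
`R(m)` is the number of pairs of Eisenstein integers whose norms sum to `m`.

As `2` is inert and the units `1, ω, ω²` represent the nonzero classes modulo `2`, sorting the pairs
counted by `R(2m)` by their classes modulo `2` gives `R(2m) + 2 R(m/2) = 3 R(m)`, where `R(m/2) = 0`
for odd `m`. Hence `R(2^t m) = (2^(t+1) - 1) R(m)` for odd `m`, and then also `3 ∣ R(m)`, because no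
class of `u - v` modulo `2` is fixed by `ω`. The theorem is the case `t = 2k - 1`, in which
`3 (4^k n + (2^(2k-1) - 2) / 3) + 2 = 2^(2k-1) (6n + 1)`; Euler's theorem gives `k`.
-/

open Finset QuadraticAlgebra YoungDiagram

/-! ### Bead sets of Young diagrams -/

theorem lt_colLen_zero_iff {μ : YoungDiagram} {i : ℕ} : i < μ.colLen 0 ↔ 0 < μ.rowLen i := by
  rw [← mem_iff_lt_colLen, mem_iff_lt_rowLen]

theorem card_eq_sum_rowLen (μ : YoungDiagram) : μ.card = ∑ i ∈ range (μ.colLen 0), μ.rowLen i := by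
  simp only [rowLen_eq_card]
  refine card_eq_sum_card_fiberwise fun c hc => ?_
  rw [mem_coe, mem_range, ← mem_iff_lt_colLen]
  exact μ.up_left_mem le_rfl (Nat.zero_le c.2) ((mem_cells c).1 hc)

/-- The hook length of the first cell of row `i`, for `i < μ.colLen 0`. -/
def bead (μ : YoungDiagram) (i : ℕ) : ℕ := μ.rowLen i + (μ.colLen 0 - 1 - i)

/-- The bead set (β-set) of a Young diagram: the hook lengths of the cells of its first column. -/
def beads (μ : YoungDiagram) : Finset ℕ := (range (μ.colLen 0)).image (bead μ)

/-- The position, among the numbers that are not beads, corresponding to column `j`. -/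
def gap (μ : YoungDiagram) (j : ℕ) : ℕ := j + (μ.colLen 0 - μ.colLen j)

theorem mem_beads {μ : YoungDiagram} {x : ℕ} : x ∈ beads μ ↔ ∃ i < μ.colLen 0, bead μ i = x := by
  simp [beads]

theorem strictAntiOn_bead (μ : YoungDiagram) : StrictAntiOn (bead μ) (range (μ.colLen 0)) := by
  rintro i - l hl hil
  have := μ.rowLen_anti i l hil.le
  rw [mem_coe, mem_range] at hl
  unfold bead
  omega

theorem card_beads (μ : YoungDiagram) : #(beads μ) = μ.colLen 0 := by
  rw [beads, card_image_of_injOn (strictAntiOn_bead μ).injOn, card_range]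

theorem zero_notMem_beads (μ : YoungDiagram) : 0 ∉ beads μ := by
  rw [mem_beads]
  rintro ⟨i, hi, h⟩
  exact (lt_colLen_zero_iff.1 hi).ne' (Nat.add_eq_zero_iff.1 h).1

theorem sum_beads (μ : YoungDiagram) : ∑ x ∈ beads μ, x = μ.card + ∑ i ∈ range #(beads μ), i := by
  rw [card_beads, beads, sum_image (strictAntiOn_bead μ).injOn, card_eq_sum_rowLen]
  simp only [bead]
  rw [sum_add_distrib, sum_range_reflect fun i => i]

theorem bead_eq_of_beads_eq {μ ν : YoungDiagram} (h : beads μ = beads ν) {i : ℕ}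
    (hi : i < μ.colLen 0) : bead μ i = bead ν i := by
  have range_bead (ξ : YoungDiagram) (hξ : ξ.colLen 0 = μ.colLen 0) :
      Set.range (fun i : Fin (μ.colLen 0) => OrderDual.toDual (bead ξ i)) =
        OrderDual.toDual '' beads ξ := by
    ext x
    simp only [beads, hξ, Set.mem_range, Fin.exists_iff, coe_image, coe_range, Set.mem_image,
      Set.mem_Iio, exists_exists_and_eq_and, exists_prop]
  have strictMono_bead (ξ : YoungDiagram) (hξ : ξ.colLen 0 = μ.colLen 0) :
      StrictMono (fun i : Fin (μ.colLen 0) => OrderDual.toDual (bead ξ i)) := fun i l hil =>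
    strictAntiOn_bead ξ (by simp [hξ]) (by simp [hξ]) hil
  have colLen_eq : ν.colLen 0 = μ.colLen 0 := by rw [← card_beads, ← card_beads, h]
  refine congrFun (((strictMono_bead μ rfl).range_inj (strictMono_bead ν colLen_eq)).1 ?_) ⟨i, hi⟩
  rw [range_bead μ rfl, range_bead ν colLen_eq, h]

theorem beads_injective : Function.Injective beads := by
  intro μ ν h
  have colLen_eq : μ.colLen 0 = ν.colLen 0 := by rw [← card_beads, ← card_beads, h]
  have rowLen_eq (i : ℕ) : μ.rowLen i = ν.rowLen i := by
    by_cases hi : i < μ.colLen 0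
    · have bead_eq := bead_eq_of_beads_eq h hi
      unfold bead at bead_eq
      omega
    · have hμ := mt lt_colLen_zero_iff.2 hi
      have hν := mt lt_colLen_zero_iff.2 (colLen_eq ▸ hi)
      omega
  ext ⟨i, j⟩
  rw [mem_cells, mem_cells, mem_iff_lt_rowLen, mem_iff_lt_rowLen, rowLen_eq]

theorem count_add_count_not (p : ℕ → Prop) [DecidablePred p] (n : ℕ) :
    Nat.count p n + Nat.count (¬ p ·) n = n := by
  rw [Nat.count_eq_card_filter_range, Nat.count_eq_card_filter_range,
    card_filter_add_card_filter_not, card_range]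

theorem exists_beads_eq {X : Finset ℕ} (h0 : 0 ∉ X) : ∃ μ : YoungDiagram, beads μ = X := by
  have lt_card (i : Fin #X) (hf : (Set.ofPred (· ∈ X)).Finite) : (i : ℕ) < #hf.toFinset := by
    simp
  let x (i : Fin #X) : ℕ := Nat.nth (· ∈ X) i.rev
  have x_mem (i : Fin #X) : x i ∈ X := Nat.nth_mem _ (lt_card i.rev)
  have x_antitone : Antitone x := fun i l hil =>
    (Nat.nth_strictMonoOn X.finite_toSet).monotoneOn (lt_card l.rev _) (lt_card i.rev _)
      (Fin.rev_le_rev.2 hil)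
  -- The row through a bead has as many cells as there are gaps below the bead.
  let w : List ℕ := List.ofFn fun i => Nat.count (· ∉ X) (x i)
  have w_sorted : w.SortedGE :=
    List.sortedGE_ofFn_iff.2 ((Nat.count_monotone _).comp_antitone x_antitone)
  have w_pos : ∀ r ∈ w, 0 < r := by
    simp only [w, List.forall_mem_ofFn_iff]
    exact fun i => (Nat.zero_le _).trans_lt <| Nat.count_strict_mono h0 <|
      Nat.pos_of_ne_zero fun hx => h0 (hx ▸ x_mem i)
  have colLen_eq : (ofRowLens w w_sorted).colLen 0 = #X := by
    rw [← length_rowLens, rowLens_length_ofRowLens w_pos, List.length_ofFn]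
  have bead_eq (i : Fin #X) : bead (ofRowLens w w_sorted) i = x i := by
    have rowLen_eq : (ofRowLens w w_sorted).rowLen i = Nat.count (· ∉ X) (x i) :=
      (rowLen_ofRowLens (i.cast List.length_ofFn.symm)).trans (by simp)
    have count_eq : Nat.count (· ∈ X) (x i) = i.rev := Nat.count_nth (lt_card i.rev)
    have := count_add_count_not (· ∈ X) (x i)
    rw [bead, rowLen_eq, colLen_eq]
    rw [Fin.val_rev] at count_eq
    omega
  refine ⟨ofRowLens w w_sorted, eq_of_subset_of_card_le ?_ (by rw [card_beads, colLen_eq])⟩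
  intro y hy
  obtain ⟨i, hi, rfl⟩ := mem_beads.1 hy
  rw [colLen_eq] at hi
  exact bead_eq ⟨i, hi⟩ ▸ x_mem _

theorem strictMono_gap (μ : YoungDiagram) : StrictMono (gap μ) := by
  intro j l hjl
  have := μ.colLen_anti j l hjl.le
  unfold gap
  omega

theorem hookNumber_add_gap {μ : YoungDiagram} {i j : ℕ} (h : (i, j) ∈ μ) :
    μ.hookNumber i j + gap μ j = bead μ i := by
  have := mem_iff_lt_rowLen.1 h
  have := mem_iff_lt_colLen.1 h
  have := μ.colLen_anti 0 j j.zero_le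
  unfold hookNumber bead gap
  omega

theorem gap_notMem_beads (μ : YoungDiagram) (j : ℕ) : gap μ j ∉ beads μ := by
  rw [mem_beads]
  rintro ⟨i, hi, h⟩
  have : j < μ.rowLen i ↔ i < μ.colLen j := by rw [← mem_iff_lt_rowLen, mem_iff_lt_colLen]
  have := μ.colLen_anti 0 j j.zero_le
  unfold bead gap at h
  omega

theorem filter_mem_beads_range_bead {μ : YoungDiagram} {i : ℕ} (hi : i < μ.colLen 0) :
    {x ∈ range (bead μ i) | x ∈ beads μ} = (Ioo i (μ.colLen 0)).image (bead μ) := by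
  ext x
  simp only [mem_filter, mem_range, mem_image, mem_Ioo, mem_beads]
  constructor
  · rintro ⟨hlt, l, hl, rfl⟩
    exact ⟨l, ⟨((strictAntiOn_bead μ).lt_iff_gt (by simpa) (by simpa)).1 hlt, hl⟩, rfl⟩
  · rintro ⟨l, ⟨hil, hl⟩, rfl⟩
    exact ⟨strictAntiOn_bead μ (by simpa) (by simpa) hil, l, hl, rfl⟩

theorem filter_notMem_beads_range_bead {μ : YoungDiagram} {i : ℕ} (hi : i < μ.colLen 0) :
    {x ∈ range (bead μ i) | x ∉ beads μ} = (range (μ.rowLen i)).image (gap μ) := by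
  refine (eq_of_subset_of_card_le (fun x hx => ?_) ?_).symm
  · obtain ⟨j, hj, rfl⟩ := mem_image.1 hx
    have hcell : (i, j) ∈ μ := mem_iff_lt_rowLen.2 (mem_range.1 hj)
    have := hookNumber_add_gap hcell
    refine mem_filter.2 ⟨mem_range.2 ?_, gap_notMem_beads μ j⟩
    unfold hookNumber at this
    omega
  · have card_range_bead := card_filter_add_card_filter_not (s := range (bead μ i)) (· ∈ beads μ)
    have injOn_Ioo : Set.InjOn (bead μ) (Ioo i (μ.colLen 0)) :=
      (strictAntiOn_bead μ).injOn.mono fun l hl => by simp_all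
    rw [filter_mem_beads_range_bead hi, card_image_of_injOn injOn_Ioo, Nat.card_Ioo,
      card_range] at card_range_bead
    rw [card_image_of_injective _ (strictMono_gap μ).injective, card_range]
    unfold bead at *
    omega

theorem mem_of_add_mul_mem {X : Finset ℕ} {t : ℕ} (hX : ∀ x, x + t ∈ X → x ∈ X) {x : ℕ} (s : ℕ)
    (hx : x + t * s ∈ X) : x ∈ X := by
  induction s with
  | zero => exact hx
  | succ s ih => exact ih (hX _ (by rwa [mul_add_one, ← add_assoc] at hx))

theorem forall_cells_not_dvd_hookNumber_iff {t : ℕ} (ht : 0 < t) {μ : YoungDiagram} :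
    (∀ c ∈ μ.cells, ¬ t ∣ μ.hookNumber c.1 c.2) ↔ ∀ x, x + t ∈ beads μ → x ∈ beads μ := by
  constructor
  · intro h x hx
    by_contra hx'
    obtain ⟨i, hi, hbead⟩ := mem_beads.1 hx
    have hgap : x ∈ (range (μ.rowLen i)).image (gap μ) := by
      rw [← filter_notMem_beads_range_bead hi]
      exact mem_filter.2 ⟨mem_range.2 (by omega), hx'⟩
    obtain ⟨j, hj, rfl⟩ := mem_image.1 hgap
    have hcell : (i, j) ∈ μ := mem_iff_lt_rowLen.2 (mem_range.1 hj)
    have := hookNumber_add_gap hcell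
    exact h (i, j) ((mem_cells _).2 hcell) (Dvd.intro 1 (by simp only; omega))
  · rintro h ⟨i, j⟩ hc ⟨s, hs⟩
    rw [mem_cells] at hc
    refine gap_notMem_beads μ j (mem_of_add_mul_mem h s ?_)
    rw [← hs, add_comm, hookNumber_add_gap hc]
    exact mem_beads.2 ⟨i, (mem_iff_lt_colLen.1 hc).trans_le (μ.colLen_anti 0 j j.zero_le), rfl⟩

/-! ### `3`-cores -/

/-- The set `{1, 4, …, 3a - 2} ∪ {2, 5, …, 3b - 1}` with `c = (a, b)`: a `3`-core has no beads on
runner `0` of the `3`-abacus, and its beads fill initial segments of the runners `1` and `2`. -/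
def threeCoreBeads (c : ℕ × ℕ) : Finset ℕ :=
  ((range c.1).image fun i => 3 * i + 1) ∪ (range c.2).image fun i => 3 * i + 2

theorem mem_threeCoreBeads {c : ℕ × ℕ} {x : ℕ} :
    x ∈ threeCoreBeads c ↔ (x % 3 = 1 ∧ x < 3 * c.1) ∨ (x % 3 = 2 ∧ x < 3 * c.2) := by
  simp only [threeCoreBeads, mem_union, mem_image, mem_range]
  constructor
  · rintro (⟨i, hi, rfl⟩ | ⟨i, hi, rfl⟩) <;> omega
  · rintro (h | h)
    · exact Or.inl ⟨x / 3, by omega, by omega⟩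
    · exact Or.inr ⟨x / 3, by omega, by omega⟩

theorem threeCoreBeads_injective : Function.Injective threeCoreBeads := by
  intro c c' h
  refine Prod.ext (eq_of_forall_lt_iff fun i => ?_) (eq_of_forall_lt_iff fun i => ?_)
  · have mem_iff : 3 * i + 1 ∈ threeCoreBeads c ↔ 3 * i + 1 ∈ threeCoreBeads c' := by rw [h]
    rw [mem_threeCoreBeads, mem_threeCoreBeads] at mem_iff
    omega
  · have mem_iff : 3 * i + 2 ∈ threeCoreBeads c ↔ 3 * i + 2 ∈ threeCoreBeads c' := by rw [h]
    rw [mem_threeCoreBeads, mem_threeCoreBeads] at mem_iff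
    omega

theorem disjoint_image_three_mul_add (a b : ℕ) :
    Disjoint ((range a).image fun i => 3 * i + 1) ((range b).image fun i => 3 * i + 2) := by
  rw [disjoint_left]
  simp only [mem_image]
  rintro x ⟨i, -, rfl⟩ ⟨l, -, h⟩
  omega

theorem three_mul_add_injective (r : ℕ) : Function.Injective fun i : ℕ => 3 * i + r :=
  fun i l h => by simpa using h

theorem card_threeCoreBeads (c : ℕ × ℕ) : #(threeCoreBeads c) = c.1 + c.2 := by
  rw [threeCoreBeads, card_union_of_disjoint (disjoint_image_three_mul_add _ _),
    card_image_of_injective _ (three_mul_add_injective 1),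
    card_image_of_injective _ (three_mul_add_injective 2), card_range, card_range]

theorem two_mul_sum_range_add (n : ℕ) : 2 * ∑ i ∈ range n, i + n = n ^ 2 := by
  induction n with
  | zero => rfl
  | succ n ih => rw [sum_range_succ]; linarith

theorem sum_threeCoreBeads (c : ℕ × ℕ) :
    ∑ x ∈ threeCoreBeads c, x + c.1 * c.2 =
      ∑ i ∈ range #(threeCoreBeads c), i + (c.1 ^ 2 + c.2 ^ 2 + c.2) := by
  rw [card_threeCoreBeads, threeCoreBeads, sum_union (disjoint_image_three_mul_add _ _),
    sum_image (three_mul_add_injective 1).injOn, sum_image (three_mul_add_injective 2).injOn]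
  simp only [sum_add_distrib, sum_const, card_range, smul_eq_mul]
  rw [← mul_sum, ← mul_sum]
  linarith [two_mul_sum_range_add c.1, two_mul_sum_range_add c.2,
    two_mul_sum_range_add (c.1 + c.2)]

theorem exists_forall_mul_add_mem_iff_lt {X : Finset ℕ} {t : ℕ} (ht : 0 < t)
    (hX : ∀ x, x + t ∈ X → x ∈ X) (r : ℕ) : ∃ a, ∀ i, t * i + r ∈ X ↔ i < a := by
  have isLowerSet : IsLowerSet {i | t * i + r ∈ X} := fun i l hli hi =>
    mem_of_add_mul_mem hX (i - l) (by
      rw [add_right_comm, ← mul_add, Nat.add_sub_cancel' hli]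
      exact hi)
  have finite : {i | t * i + r ∈ X}.Finite :=
    X.finite_toSet.preimage fun i _ l _ h => by simpa [ht.ne'] using h
  obtain ⟨a, ha⟩ := isLowerSet.eq_univ_or_Iio.resolve_left
    fun h => Set.infinite_univ (h ▸ finite)
  exact ⟨a, Set.ext_iff.1 ha⟩

theorem exists_threeCoreBeads_eq_iff {X : Finset ℕ} :
    (∃ c, threeCoreBeads c = X) ↔ 0 ∉ X ∧ ∀ x, x + 3 ∈ X → x ∈ X := by
  constructor
  · rintro ⟨c, rfl⟩
    simp only [mem_threeCoreBeads]
    exact ⟨by omega, fun x => by omega⟩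
  · rintro ⟨h0, hX⟩
    obtain ⟨z, hz⟩ := exists_forall_mul_add_mem_iff_lt three_pos hX 0
    obtain ⟨a, ha⟩ := exists_forall_mul_add_mem_iff_lt three_pos hX 1
    obtain ⟨b, hb⟩ := exists_forall_mul_add_mem_iff_lt three_pos hX 2
    have hz0 : ¬ 0 < z := mt (hz 0).2 h0
    refine ⟨(a, b), ?_⟩
    ext x
    rw [mem_threeCoreBeads, ← Nat.div_add_mod x 3]
    obtain hx | hx | hx : x % 3 = 0 ∨ x % 3 = 1 ∨ x % 3 = 2 := by omega
    · rw [hx, hz]; omega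
    · rw [hx, ha]; omega
    · rw [hx, hb]; omega

theorem rowLens_youngDiagram {n : ℕ} (l : n.Partition) :
    l.youngDiagram.rowLens = l.parts.sort (· ≥ ·) :=
  rowLens_ofRowLens_eq_self fun _ hx => l.parts_pos ((Multiset.mem_sort _).1 hx)

theorem youngDiagram_injective {n : ℕ} :
    Function.Injective (Nat.Partition.youngDiagram : n.Partition → YoungDiagram) := fun l l' h =>
  Nat.Partition.ext <| by
    rw [← Multiset.sort_eq l.parts (· ≥ ·), ← rowLens_youngDiagram, h, rowLens_youngDiagram,
      Multiset.sort_eq]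

theorem exists_youngDiagram_eq_iff {n : ℕ} {μ : YoungDiagram} :
    (∃ l : n.Partition, l.youngDiagram = μ) ↔ μ.card = n := by
  have sum_rowLens (ν : YoungDiagram) : ν.rowLens.sum = ν.card := (card_eq_sum_rowLen ν).symm
  constructor
  · rintro ⟨l, rfl⟩
    rw [← sum_rowLens, rowLens_youngDiagram, ← Multiset.sum_coe, Multiset.sort_eq, l.parts_sum]
  · rintro rfl
    have sort_rowLens : (μ.rowLens : Multiset ℕ).sort (· ≥ ·) = μ.rowLens :=
      List.Perm.eq_of_pairwise' (Multiset.pairwise_sort _ _) μ.rowLens_sorted.pairwise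
        (Multiset.coe_eq_coe.1 (Multiset.sort_eq _ _))
    refine ⟨⟨μ.rowLens, fun hi => μ.pos_of_mem_rowLens _ (Multiset.mem_coe.1 hi), ?_⟩, ?_⟩
    · rw [Multiset.sum_coe, sum_rowLens]
    · simp only [Nat.Partition.youngDiagram, sort_rowLens]
      exact ofRowLens_to_rowLens_eq_self

theorem exists_partition_beads_eq_iff {n : ℕ} {X : Finset ℕ} :
    (∃ l : n.Partition, beads l.youngDiagram = X) ↔
      0 ∉ X ∧ ∑ x ∈ X, x = n + ∑ i ∈ range #X, i := by
  constructor
  · rintro ⟨l, rfl⟩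
    exact ⟨zero_notMem_beads _, by rw [sum_beads, exists_youngDiagram_eq_iff.1 ⟨l, rfl⟩]⟩
  · rintro ⟨h0, hsum⟩
    obtain ⟨μ, rfl⟩ := exists_beads_eq h0
    obtain ⟨l, rfl⟩ := exists_youngDiagram_eq_iff.2 (Nat.add_right_cancel (sum_beads μ ▸ hsum))
    exact ⟨l, rfl⟩

theorem mem_corePartitions_iff {t n : ℕ} (ht : 0 < t) {l : n.Partition} :
    l ∈ corePartitions t n ↔
      ∀ x, x + t ∈ beads l.youngDiagram → x ∈ beads l.youngDiagram := by
  rw [← forall_cells_not_dvd_hookNumber_iff ht, corePartitions, mem_filter_univ,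
    Nat.Partition.IsCore]

theorem exists_mem_corePartitions_three_beads_eq_iff {n : ℕ} {X : Finset ℕ} :
    (∃ l ∈ corePartitions 3 n, beads l.youngDiagram = X) ↔
      ∃ c : ℕ × ℕ, n + c.1 * c.2 = c.1 ^ 2 + c.2 ^ 2 + c.2 ∧ threeCoreBeads c = X := by
  constructor
  · rintro ⟨l, hl, rfl⟩
    obtain ⟨c, hc⟩ := exists_threeCoreBeads_eq_iff.2
      ⟨zero_notMem_beads l.youngDiagram, (mem_corePartitions_iff three_pos).1 hl⟩
    have hsum := (exists_partition_beads_eq_iff.1 ⟨l, rfl⟩).2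
    have := sum_threeCoreBeads c
    rw [← hc] at hsum
    exact ⟨c, by omega, hc⟩
  · rintro ⟨c, hn, rfl⟩
    obtain ⟨h0, hcore⟩ := exists_threeCoreBeads_eq_iff.1 ⟨c, rfl⟩
    have := sum_threeCoreBeads c
    obtain ⟨l, hl⟩ := exists_partition_beads_eq_iff.2 ⟨h0, (by omega :
      ∑ x ∈ threeCoreBeads c, x = n + ∑ i ∈ range #(threeCoreBeads c), i)⟩
    exact ⟨l, (mem_corePartitions_iff three_pos).2 (hl ▸ hcore), hl⟩

/-! ### Pairs of Eisenstein integers with a given sum of norms -/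

theorem card_eq_mul_card_filter_of_existsUnique_iterate {α : Type*} {S : Finset α} {f : α → α}
    (hf : f.Injective) (hS : Set.MapsTo f S S) (P : α → Prop) [DecidablePred P] {m : ℕ}
    (hP : ∀ v ∈ S, ∃! k : Fin m, P (f^[k] v)) : #S = m * #{v ∈ S | P v} := by
  have card_filter_iterate (k : ℕ) : #{v ∈ S | P (f^[k] v)} = #{v ∈ S | P v} := by
    classical
    have image_eq : S.image f^[k] = S :=
      eq_of_subset_of_card_le (image_subset_iff.2 (hS.iterate k))
        (card_image_of_injective S (hf.iterate k)).ge
    conv_rhs => rw [← image_eq, filter_image, card_image_of_injective _ (hf.iterate k)]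
  calc #S = ∑ v ∈ S, #{k : Fin m | P (f^[k] v)} := by
        rw [card_eq_sum_ones]
        exact sum_congr rfl fun v hv => ((Fintype.existsUnique_iff_card_one _).1 (hP v hv)).symm
    _ = ∑ k : Fin m, #{v ∈ S | P (f^[k] v)} :=
        sum_card_bipartiteAbove_eq_sum_card_bipartiteBelow fun v (k : Fin m) => P (f^[k] v)
    _ = m * #{v ∈ S | P v} := by simp [card_filter_iterate]

theorem existsUnique_fin_three {P : Fin 3 → Prop} :
    (∃! k, P k) ↔ P 0 ∧ ¬ P 1 ∧ ¬ P 2 ∨ ¬ P 0 ∧ P 1 ∧ ¬ P 2 ∨ ¬ P 0 ∧ ¬ P 1 ∧ P 2 := by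
  simp only [ExistsUnique, Fin.forall_fin_succ, Fin.isValue, Fin.succ_zero_eq_one,
    Fin.succ_one_eq_two, IsEmpty.forall_iff, and_true, Fin.exists_fin_succ, implies_true,
    one_ne_zero, imp_false, Fin.reduceEq, true_and, zero_ne_one, IsEmpty.exists_iff, or_false]
  tauto

/-- The Eisenstein integers `ℤ[ω]`, where `ω² = -1 - ω`, so that `ω` is a primitive cube root of
unity. -/
abbrev EisensteinInt := QuadraticAlgebra ℤ (-1) (-1)

namespace EisensteinInt

theorem norm_eq (v : EisensteinInt) : v.norm = v.re ^ 2 - v.re * v.im + v.im ^ 2 := by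
  rw [norm_def]; ring

theorem norm_nonneg (v : EisensteinInt) : 0 ≤ v.norm := by
  rw [norm_eq]
  nlinarith [sq_nonneg (2 * v.re - v.im), sq_nonneg v.im]

@[simp]
theorem re_omega_mul (v : EisensteinInt) : (ω * v).re = -v.im := by simp

@[simp]
theorem im_omega_mul (v : EisensteinInt) : (ω * v).im = v.re - v.im := by simp [sub_eq_add_neg]

theorem norm_omega : norm (ω : EisensteinInt) = 1 := by simp [norm_eq]

theorem norm_omega_mul (v : EisensteinInt) : (ω * v).norm = v.norm := by
  rw [map_mul, norm_omega, one_mul]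

theorem omega_mul_injective : Function.Injective ((ω : EisensteinInt) * ·) :=
  (isUnit_iff_norm_isUnit.2 (norm_omega ▸ isUnit_one)).mul_right_injective

theorem parallelogram_norm (u v : EisensteinInt) :
    (u + v).norm + (u - v).norm = 2 * (u.norm + v.norm) := by
  simp only [norm_eq, re_add, re_sub, im_add, im_sub]
  ring

theorem norm_two_mul (v : EisensteinInt) : (2 * v).norm = 4 * v.norm := by
  rw [two_mul]
  simpa [← mul_assoc, ← two_mul] using parallelogram_norm v v

theorem finite_setOf_norm_le (m : ℤ) : {v : EisensteinInt | v.norm ≤ m}.Finite := by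
  refine (((Set.finite_Icc (-2 * m) (2 * m)).prod (Set.finite_Icc (-2 * m) (2 * m))).preimage
    (equivProd (-1) (-1) : EisensteinInt ≃ ℤ × ℤ).injective.injOn).subset fun v hv => ?_
  have bound {a b : ℤ} (h : a ^ 2 - a * b + b ^ 2 ≤ m) : -2 * m ≤ a ∧ a ≤ 2 * m := by
    have : 3 * a ^ 2 ≤ 4 * m := by nlinarith [sq_nonneg (a - 2 * b)]
    constructor <;> nlinarith [Int.le_self_sq a, Int.le_self_sq (-a)]
  rw [Set.mem_ofPred_eq, norm_eq] at hv
  exact ⟨bound hv, bound (a := v.im) (b := v.re) (by linarith)⟩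

theorem two_dvd_iff {v : EisensteinInt} : 2 ∣ v ↔ 2 ∣ v.re ∧ 2 ∣ v.im := by
  rw [← algebraMap_dvd_iff (r := 2)]
  rfl

theorem two_dvd_norm_iff {v : EisensteinInt} : 2 ∣ v.norm ↔ 2 ∣ v := by
  rw [two_dvd_iff, norm_eq]
  simp only [← even_iff_two_dvd, Int.even_add, Int.even_sub, Int.even_mul,
    Int.even_pow, ne_eq, OfNat.ofNat_ne_zero, not_false_eq_true, and_true]
  tauto

theorem existsUnique_two_dvd_sub_omega_pow_mul {u v : EisensteinInt} (hu : ¬ 2 ∣ u)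
    (hv : ¬ 2 ∣ v) : ∃! k : Fin 3, 2 ∣ u - ω ^ (k : ℕ) * v := by
  rw [two_dvd_iff] at hu hv
  simp only [existsUnique_fin_three, two_dvd_iff, Fin.val_zero, Fin.val_one, Fin.val_two,
    pow_zero, pow_one, pow_two, one_mul, mul_assoc, re_sub, im_sub, re_omega_mul, im_omega_mul]
  omega

/-- The Eisenstein integers of norm `m`. -/
noncomputable def normReps (m : ℤ) : Finset EisensteinInt :=
  ((finite_setOf_norm_le m).subset fun _ hv => le_of_eq hv : {v | v.norm = m}.Finite).toFinset

/-- The pairs of Eisenstein integers whose norms sum to `m`. -/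
noncomputable def normPairs (m : ℤ) : Finset (EisensteinInt × EisensteinInt) :=
  (((finite_setOf_norm_le m).prod (finite_setOf_norm_le m)).subset fun w hw =>
    ⟨hw ▸ le_add_of_nonneg_right (norm_nonneg w.2), hw ▸ le_add_of_nonneg_left (norm_nonneg w.1)⟩ :
      {w : EisensteinInt × EisensteinInt | w.1.norm + w.2.norm = m}.Finite).toFinset

@[simp]
theorem mem_normReps {m : ℤ} {v : EisensteinInt} : v ∈ normReps m ↔ v.norm = m := by
  simp [normReps]

@[simp]
theorem mem_normPairs {m : ℤ} {w : EisensteinInt × EisensteinInt} :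
    w ∈ normPairs m ↔ w.1.norm + w.2.norm = m := by
  simp [normPairs]

open Classical in
theorem card_filter_two_dvd_sub_normPairs_two_mul (m : ℤ) :
    #{w ∈ normPairs (2 * m) | 2 ∣ w.1 - w.2} = #(normPairs m) := by
  refine (card_nbij (fun w => (w.1 + w.2, w.1 - w.2)) ?_ ?_ ?_).symm
  · rintro ⟨u, v⟩ hw
    simp only [mem_coe, mem_normPairs, mem_filter] at hw ⊢
    exact ⟨by rw [parallelogram_norm, hw], ⟨v, by ring⟩⟩
  · rintro ⟨u, v⟩ - ⟨u', v'⟩ - h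
    simp only [Prod.mk.injEq, QuadraticAlgebra.ext_iff, re_add, im_add, re_sub, im_sub] at h ⊢
    omega
  · rintro ⟨u, v⟩ hw
    simp only [mem_coe, mem_normPairs, mem_filter] at hw
    obtain ⟨hnorm, c, hc⟩ := hw
    obtain rfl : u = (v + c) + c := by linear_combination hc
    have hparallelogram := parallelogram_norm (v + c) c
    rw [add_sub_cancel_right] at hparallelogram
    refine ⟨(v + c, c), ?_, by simp⟩
    rw [mem_coe, mem_normPairs]
    linarith

open Classical in
theorem card_filter_two_dvd_normPairs_four_mul (m : ℤ) :
    #{w ∈ normPairs (4 * m) | 2 ∣ w} = #(normPairs m) := by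
  refine (card_nbij (2 * ·) ?_ ?_ ?_).symm
  · rintro ⟨u, v⟩ hw
    simp only [mem_coe, mem_normPairs, mem_filter] at hw ⊢
    refine ⟨?_, dvd_mul_right _ _⟩
    simp only [Prod.fst_mul, Prod.snd_mul, Prod.fst_ofNat, Prod.snd_ofNat, norm_two_mul]
    rw [← hw, mul_add]
  · rintro u - v - h
    simpa [Prod.ext_iff, QuadraticAlgebra.ext_iff] using h
  · rintro w hw
    simp only [mem_coe, mem_normPairs, mem_filter] at hw
    obtain ⟨hnorm, c, rfl⟩ := hw
    refine ⟨c, ?_, rfl⟩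
    simp only [Prod.fst_mul, Prod.snd_mul, Prod.fst_ofNat, Prod.snd_ofNat, norm_two_mul] at hnorm
    rw [mem_coe, mem_normPairs]
    linarith

open Classical in
theorem filter_two_dvd_normPairs_two_mul_of_odd {m : ℤ} (hm : Odd m) :
    {w ∈ normPairs (2 * m) | 2 ∣ w} = ∅ := by
  refine filter_eq_empty_iff.2 ?_
  rintro _ hw ⟨c, rfl⟩
  simp only [mem_normPairs, Prod.fst_mul, Prod.snd_mul, Prod.fst_ofNat, Prod.snd_ofNat,
    norm_two_mul] at hw
  rw [← Int.not_even_iff_odd] at hm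
  exact hm ⟨c.1.norm + c.2.norm, by linarith⟩

theorem two_dvd_fst_iff_of_mem_normPairs {m : ℤ} {w : EisensteinInt × EisensteinInt}
    (hw : w ∈ normPairs (2 * m)) : 2 ∣ w.1 ↔ 2 ∣ w.2 := by
  rw [mem_normPairs] at hw
  rw [← two_dvd_norm_iff, ← two_dvd_norm_iff]
  omega

open Classical in
theorem card_filter_not_two_dvd_fst_normPairs (m : ℤ) :
    #{w ∈ normPairs (2 * m) | ¬ 2 ∣ w.1} =
      3 * #{w ∈ normPairs (2 * m) | ¬ 2 ∣ w.1 ∧ 2 ∣ w.1 - w.2} := by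
  rw [← filter_filter]
  refine card_eq_mul_card_filter_of_existsUnique_iterate (f := Prod.map id (ω * ·))
    (Function.injective_id.prodMap omega_mul_injective) (fun w hw => ?_) _ fun w hw => ?_
  · simpa [norm_omega_mul] using hw
  · obtain ⟨hw, hfst⟩ := mem_filter.1 hw
    simpa [Prod.map_iterate, mul_left_iterate] using existsUnique_two_dvd_sub_omega_pow_mul hfst
      (mt (two_dvd_fst_iff_of_mem_normPairs hw).2 hfst)

open Classical in
theorem card_normPairs_two_mul_add (m : ℤ) :
    #(normPairs (2 * m)) + 2 * #{w ∈ normPairs (2 * m) | 2 ∣ w} = 3 * #(normPairs m) := by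
  have filter_two_dvd_fst : {w ∈ normPairs (2 * m) | 2 ∣ w.1} = {w ∈ normPairs (2 * m) | 2 ∣ w} :=
    filter_congr fun w hw => by
      rw [prod_dvd_iff]
      exact (and_iff_left_of_imp (two_dvd_fst_iff_of_mem_normPairs hw).1).symm
  have filter_two_dvd_sub :
      {w ∈ normPairs (2 * m) | 2 ∣ w.1 ∧ 2 ∣ w.1 - w.2} = {w ∈ normPairs (2 * m) | 2 ∣ w.1} :=
    filter_congr fun w hw => and_iff_left_of_imp fun h =>
      dvd_sub h ((two_dvd_fst_iff_of_mem_normPairs hw).1 h)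
  have card_fst := card_filter_add_card_filter_not (s := normPairs (2 * m)) (2 ∣ ·.1)
  have card_sub := card_filter_add_card_filter_not
    (s := {w ∈ normPairs (2 * m) | 2 ∣ w.1 - w.2}) (2 ∣ ·.1)
  simp only [filter_filter, and_comm (a := _ ∣ _ - _)] at card_sub
  rw [filter_two_dvd_sub, filter_two_dvd_fst, card_filter_two_dvd_sub_normPairs_two_mul] at card_sub
  rw [filter_two_dvd_fst, card_filter_not_two_dvd_fst_normPairs] at card_fst
  omega

theorem card_normPairs_two_pow_mul_add {m : ℤ} (hm : Odd m) (t : ℕ) :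
    #(normPairs (2 ^ t * m)) + #(normPairs m) = 2 ^ (t + 1) * #(normPairs m) := by
  induction t using Nat.twoStepInduction with
  | zero => simp [two_mul]
  | one =>
    have recurrence := card_normPairs_two_mul_add m
    rw [filter_two_dvd_normPairs_two_mul_of_odd hm, card_empty] at recurrence
    rw [pow_one]
    omega
  | more t ih₀ ih₁ =>
    have recurrence := card_normPairs_two_mul_add (2 ^ (t + 1) * m)
    rw [show 2 * (2 ^ (t + 1) * m) = 4 * (2 ^ t * m) by ring,
      card_filter_two_dvd_normPairs_four_mul] at recurrence
    rw [show 2 ^ (t + 2) * m = 4 * (2 ^ t * m) by ring]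
    simp only [pow_succ', mul_assoc] at ih₀ ih₁ recurrence ⊢
    omega

theorem three_dvd_card_normPairs {m : ℤ} (hm : Odd m) : 3 ∣ #(normPairs m) := by
  classical
  refine ⟨_, card_eq_mul_card_filter_of_existsUnique_iterate
    (f := Prod.map (ω * ·) (ω * ·)) (omega_mul_injective.prodMap omega_mul_injective)
    (fun w hw => ?_) (fun w => 2 ∣ 1 - (w.1 - w.2)) fun w hw => ?_⟩
  · simpa [norm_omega_mul] using hw
  · have not_two_dvd_sub : ¬ 2 ∣ w.1 - w.2 := fun h => by
      have two_dvd_norm_fst_iff : 2 ∣ w.1.norm ↔ 2 ∣ w.2.norm := by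
        rw [two_dvd_norm_iff, two_dvd_norm_iff, dvd_iff_dvd_of_dvd_sub h]
      rw [mem_normPairs] at hw
      obtain ⟨c, rfl⟩ := hm
      omega
    have not_two_dvd_one : ¬ (2 : EisensteinInt) ∣ 1 := by simp [two_dvd_iff]
    simpa [Prod.map_iterate, mul_left_iterate, mul_sub] using
      existsUnique_two_dvd_sub_omega_pow_mul not_two_dvd_one not_two_dvd_sub

theorem norm_eq_sq_sub (v : EisensteinInt) :
    v.norm = (v.re + v.im) ^ 2 - 3 * (v.re * v.im) := by
  rw [norm_eq]; ring

theorem three_dvd_norm_iff {v : EisensteinInt} : 3 ∣ v.norm ↔ 3 ∣ v.re + v.im := by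
  rw [norm_eq_sq_sub, dvd_sub_left (dvd_mul_right _ _),
    Int.prime_three.dvd_pow_iff_dvd two_ne_zero]

theorem norm_emod_three_ne_two (v : EisensteinInt) : v.norm % 3 ≠ 2 := by
  rw [norm_eq_sq_sub, Int.sub_mul_emod_self_left, pow_two, Int.mul_emod]
  obtain h | h | h : (v.re + v.im) % 3 = 0 ∨ (v.re + v.im) % 3 = 1 ∨ (v.re + v.im) % 3 = 2 := by
    omega
  all_goals simp [h]

/-- The Eisenstein integer `1 - (1 + 2ω)(a + bω)`, whose norm is `3n + 1` when `(a, b)` are the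
numbers of beads on the runners `1` and `2` of the abacus of a `3`-core of size `n`. -/
def coreElement (c : ℕ × ℕ) : EisensteinInt := ⟨1 - c.1 + 2 * c.2, c.2 - 2 * c.1⟩

theorem norm_coreElement_eq_iff {n : ℕ} {c : ℕ × ℕ} :
    (coreElement c).norm = 3 * n + 1 ↔ n + c.1 * c.2 = c.1 ^ 2 + c.2 ^ 2 + c.2 := by
  zify
  simp only [norm_eq, coreElement]
  constructor <;> intro h <;> linarith

theorem coreElement_injective : Function.Injective coreElement := by
  rintro ⟨a, b⟩ ⟨a', b'⟩ h
  simp only [coreElement, QuadraticAlgebra.ext_iff, Prod.mk.injEq] at h ⊢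
  omega

theorem mem_range_coreElement {v : EisensteinInt} : v ∈ Set.range coreElement ↔
    (v.re + v.im) % 3 = 1 ∧ 0 < v.re - 2 * v.im ∧ 0 < 2 * v.re - v.im := by
  constructor
  · rintro ⟨c, rfl⟩
    simp only [coreElement]
    omega
  · rintro ⟨hmod, hfst, hsnd⟩
    refine ⟨(((v.re - 2 * v.im) / 3).toNat, ((2 * v.re - v.im) / 3).toNat), ?_⟩
    simp only [coreElement, QuadraticAlgebra.ext_iff]
    omega

theorem existsUnique_neg_iterate_emod_three_eq_one {v : EisensteinInt}
    (hv : ¬ 3 ∣ v.re + v.im) :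
    ∃! k : Fin 2, ((Neg.neg^[k] v).re + (Neg.neg^[k] v).im) % 3 = 1 := by
  simp only [ExistsUnique, Fin.exists_fin_two, Fin.forall_fin_two, Fin.val_zero, Fin.val_one,
    Function.iterate_zero_apply, Function.iterate_one, re_neg, im_neg, zero_ne_one, one_ne_zero,
    imp_false, implies_true, true_and, and_true]
  omega

theorem existsUnique_omega_pow_mul_mem_sector {v : EisensteinInt} (hv : ¬ 3 ∣ v.re + v.im) :
    ∃! k : Fin 3, 0 < (ω ^ (k : ℕ) * v).re - 2 * (ω ^ (k : ℕ) * v).im ∧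
      0 < 2 * (ω ^ (k : ℕ) * v).re - (ω ^ (k : ℕ) * v).im := by
  simp only [existsUnique_fin_three, Fin.val_zero, Fin.val_one, Fin.val_two, pow_zero, pow_one,
    pow_two, one_mul, mul_assoc, re_omega_mul, im_omega_mul]
  omega

open Classical in
theorem card_normReps_eq_six_mul {m : ℤ} (hm : ¬ 3 ∣ m) :
    #(normReps m) = 6 * #{v ∈ normReps m | v ∈ Set.range coreElement} := by
  have not_three_dvd_re_add_im {v : EisensteinInt} (hv : v ∈ normReps m) : ¬ 3 ∣ v.re + v.im := by
    rwa [← three_dvd_norm_iff, mem_normReps.1 hv]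
  simp only [mem_range_coreElement]
  rw [← filter_filter, show 6 = 2 * 3 by rfl, mul_assoc,
    ← card_eq_mul_card_filter_of_existsUnique_iterate omega_mul_injective,
    ← card_eq_mul_card_filter_of_existsUnique_iterate neg_injective]
  · intro v hv
    simpa using hv
  · exact fun v hv => existsUnique_neg_iterate_emod_three_eq_one (not_three_dvd_re_add_im hv)
  · intro v hv
    simp only [coe_filter, mem_normReps, Set.mem_ofPred_eq, norm_omega_mul] at hv ⊢
    refine ⟨hv.1, ?_⟩
    rw [re_omega_mul, im_omega_mul]
    omega
  · intro v hv
    simpa [mul_left_iterate] using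
      existsUnique_omega_pow_mul_mem_sector (not_three_dvd_re_add_im (mem_filter.1 hv).1)

open Classical in
theorem card_normReps_eq_six_mul_card_corePartitions (n : ℕ) :
    #(normReps (3 * n + 1)) = 6 * #(corePartitions 3 n) := by
  rw [card_normReps_eq_six_mul (by omega), ← card_preimage _ _ coreElement_injective.injOn,
    ← card_image_of_injective _ threeCoreBeads_injective,
    ← card_image_of_injective (corePartitions 3 n) (beads_injective.comp youngDiagram_injective)]
  congr 2
  ext X
  simp only [mem_image, mem_preimage, mem_normReps, norm_coreElement_eq_iff, Function.comp_apply,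
    exists_mem_corePartitions_three_beads_eq_iff]

theorem card_normPairs_eq_mul_A₃ (n : ℕ) : #(normPairs (3 * n + 2)) = 36 * A₃ n := by
  have norm_bounds (w : EisensteinInt × EisensteinInt) :=
    And.intro (norm_nonneg w.1) (norm_nonneg w.2)
  have norm_mod (w : EisensteinInt × EisensteinInt) :=
    And.intro (norm_emod_three_ne_two w.1) (norm_emod_three_ne_two w.2)
  have card_fiber {s : ℕ × ℕ} (hs : s ∈ antidiagonal n) :
      #{w ∈ normPairs (3 * n + 2) | ((w.1.norm / 3).toNat, (w.2.norm / 3).toNat) = s} =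
        36 * (#(corePartitions 3 s.1) * #(corePartitions 3 s.2)) := by
    rw [show 36 * (#(corePartitions 3 s.1) * #(corePartitions 3 s.2)) =
        6 * #(corePartitions 3 s.1) * (6 * #(corePartitions 3 s.2)) by ring,
      ← card_normReps_eq_six_mul_card_corePartitions,
      ← card_normReps_eq_six_mul_card_corePartitions, ← card_product]
    congr 1
    ext w
    have := norm_bounds w
    have := norm_mod w
    rw [HasAntidiagonal.mem_antidiagonal] at hs
    simp only [mem_filter, mem_normPairs, mem_product, mem_normReps, Prod.ext_iff]
    omega
  rw [A₃, corePartitionPairs, card_sigma, mul_sum, card_eq_sum_card_fiberwise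
    (f := fun w => ((w.1.norm / 3).toNat, (w.2.norm / 3).toNat)) (t := antidiagonal n)]
  · exact sum_congr rfl fun s hs => by rw [card_fiber hs, card_product]
  · intro w hw
    have := norm_bounds w
    have := norm_mod w
    simp only [mem_coe, mem_normPairs, HasAntidiagonal.mem_antidiagonal] at hw ⊢
    omega

end EisensteinInt

open EisensteinInt

theorem three_dvd_four_pow_sub_one (k : ℕ) : 3 ∣ 4 ^ k - 1 := by
  simpa using Nat.sub_dvd_pow_sub_pow 4 1 k

theorem three_dvd_two_pow_two_mul_sub_one_sub_two {k : ℕ} (hk : 0 < k) :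
    3 ∣ 2 ^ (2 * k - 1) - 2 := by
  obtain ⟨k, rfl⟩ := Nat.exists_eq_add_one.2 hk
  rw [show 2 * (k + 1) - 1 = 2 * k + 1 by omega, pow_succ', pow_mul, ← Nat.mul_sub_one]
  exact (three_dvd_four_pow_sub_one k).mul_left 2

theorem A₃_add_card_normPairs {k : ℕ} (hk : 0 < k) (n : ℕ) :
    36 * A₃ (4 ^ k * n + (2 ^ (2 * k - 1) - 2) / 3) + #(normPairs (6 * n + 1)) =
      4 ^ k * #(normPairs (6 * n + 1)) := by
  have two_pow_succ : 2 ^ (2 * k - 1 + 1) = 4 ^ k := by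
    rw [Nat.sub_add_cancel (by omega), pow_mul, show 2 ^ 2 = 4 by rfl]
  have three_mul_add_two : 3 * (4 ^ k * n + (2 ^ (2 * k - 1) - 2) / 3) + 2 =
      2 ^ (2 * k - 1) * (6 * n + 1) := by
    have two_le : 2 ≤ 2 ^ (2 * k - 1) := Nat.le_self_pow (by omega) 2
    rw [mul_add, Nat.mul_div_cancel' (three_dvd_two_pow_two_mul_sub_one_sub_two hk), add_assoc,
      Nat.sub_add_cancel two_le, ← two_pow_succ]
    ring
  have hodd : Odd (6 * n + 1 : ℤ) := ⟨3 * n, by ring⟩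
  have pairs_eq := card_normPairs_two_pow_mul_add hodd (2 * k - 1)
  rw [two_pow_succ] at pairs_eq
  rw [← pairs_eq, ← card_normPairs_eq_mul_A₃]
  congr 3
  exact_mod_cast three_mul_add_two

theorem exists_two_mul_eq_and_three_mul_prime_pow_dvd {p : ℕ} (hp : p.Prime) (hp2 : p ≠ 2)
    (j : ℕ) : ∃ k₀, 0 < k₀ ∧ 2 * k₀ = p ^ j * (p - 1) ∧
      ∀ s, 3 * p ^ j ∣ 4 ^ (k₀ * s) - 1 := by
  obtain ⟨q, hq⟩ := hp.even_sub_one hp2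
  have q_pos : 0 < q := by have := hp.two_le; omega
  have two_mul_eq : 2 * (p ^ j * q) = p ^ j * (p - 1) := by rw [hq]; ring
  have prime_pow_dvd : p ^ (j + 1) ∣ 4 ^ (p ^ j * q) - 1 := by
    have coprime_two : Nat.Coprime 2 (p ^ (j + 1)) :=
      ((Nat.coprime_primes Nat.prime_two hp).2 hp2.symm).pow_right _
    have euler := Nat.ModEq.pow_totient coprime_two
    rw [Nat.totient_prime_pow_succ hp, ← two_mul_eq, pow_mul] at euler
    exact (Nat.modEq_iff_dvd' (Nat.pow_pos four_pos)).1 euler.symm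
  have three_mul_prime_pow_dvd : 3 * p ^ j ∣ 4 ^ (p ^ j * q) - 1 := by
    obtain rfl | hp3 := eq_or_ne p 3
    · rwa [← pow_succ']
    · have coprime_three : Nat.Coprime 3 (p ^ j) :=
        ((Nat.coprime_primes Nat.prime_three hp).2 hp3.symm).pow_right _
      exact coprime_three.mul_dvd_of_dvd_of_dvd (three_dvd_four_pow_sub_one _)
        ((pow_dvd_pow p j.le_succ).trans prime_pow_dvd)
  refine ⟨p ^ j * q, Nat.mul_pos (pow_pos hp.pos j) q_pos, two_mul_eq, fun s => ?_⟩
  rw [pow_mul]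
  simpa using three_mul_prime_pow_dvd.trans (Nat.sub_dvd_pow_sub_pow _ 1 s)

theorem mainTheorem3_general {k M : ℕ} (hk : 0 < k) (hM : 3 * M ∣ 4 ^ k - 1) (n : ℕ) :
    3 ∣ 2 ^ (2 * k - 1) - 2 ∧ A₃ (4 ^ k * n + (2 ^ (2 * k - 1) - 2) / 3) ≡ 0 [MOD M] := by
  refine ⟨three_dvd_two_pow_two_mul_sub_one_sub_two hk, (Nat.modEq_zero_iff_dvd).2 ?_⟩
  obtain ⟨r, hr⟩ := three_dvd_card_normPairs (m := 6 * n + 1) ⟨3 * n, by ring⟩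
  have card_identity := A₃_add_card_normPairs hk n
  set a := A₃ (4 ^ k * n + (2 ^ (2 * k - 1) - 2) / 3)
  have twelve_mul : 3 * (4 * a) = (4 ^ k - 1) * r := by
    rw [Nat.sub_one_mul]
    rw [hr, mul_left_comm] at card_identity
    omega
  have coprime_four : M.Coprime 4 := by
    rw [← Nat.coprime_pow_right_iff hk]
    exact ((Nat.coprime_self_sub_left (Nat.pow_pos four_pos)).2
      (Nat.coprime_one_left _)).coprime_dvd_left (dvd_of_mul_left_dvd hM)
  exact coprime_four.dvd_of_dvd_mul_left
    (Nat.dvd_of_mul_dvd_mul_left three_pos (twelve_mul ▸ hM.mul_right r))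

theorem mainTheorem3 (p j : ℕ) (hp : p.Prime) (hp2 : p ≠ 2) (hj : 1 ≤ j) :
    ∃ k₀ : ℕ, 0 < k₀ ∧ 2 * k₀ = p ^ j * (p - 1) ∧
      ∀ n α : ℕ,
        3 ∣ 2 ^ (2 * k₀ * (α + 1) - 1) - 2 ∧
        A₃ (4 ^ (k₀ * (α + 1)) * n + (2 ^ (2 * k₀ * (α + 1) - 1) - 2) / 3) ≡ 0 [MOD p ^ j] := by
  obtain ⟨k₀, hpos, hk₀, hdvd⟩ := exists_two_mul_eq_and_three_mul_prime_pow_dvd hp hp2 j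
  exact ⟨k₀, hpos, hk₀, fun n α => mul_assoc 2 k₀ (α + 1) ▸
    mainTheorem3_general (Nat.mul_pos hpos α.succ_pos) (hdvd (α + 1)) n⟩
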